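/- Parity automata $(Q,\Sigma,I,T,\mathrm{pri})$ have a finite state set $Q$, a non-empty set $I\subseteq Q$ of initial states, transitions $T\subseteq Q\times\Sigma\times Q$, and a priority function $\mathrm{pri}:T\to\Pi$ into a finite set $\Pi\subset\mathbb N$. A run on $\alpha\in\Sigma^\omega$ is a sequence $q_0q_1\cdots$ with $q_0\in I$ and $(q_i,\alpha_i,q_{i+1})\in T$ for all $i$; it is accepting if the highest priority occurring infinitely often on its transitions is even. A (nondeterministic) Büchi automaton is defined likewise with a set $F\subseteq T$ of accepting transitions in place of $\mathrm{pri}$, and a run is accepting if it takes transitions of $F$ infinitely often. A word is accepted if it has an accepting run, and an automaton recognises the set of words it accepts. Let $\Pi=\{i\in\mathbb N\mid \min\Pi\le i\le\max\Pi\}$ with $\min\Pi\in\{0,1\}$ and $\pi=\max\Pi\ge 2$, and let $\pi_e$ be the largest even element of $\Pi$. For a non-empty $\Pi'\subseteq\Pi$, let $\mathrm{opt}\,\Pi'$ be the largest even element of $\Pi'$ if there is one, and otherwise its least element. For a set $Q$ of $n\ge 1$ states, the full parity automaton $\mathcal P_n^\Pi$ has states $Q$, all of them initial, the alphabet $\Sigma$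 of all functions $\sigma:Q\times Q\to 2^\Pi$, the transitions $(q,\sigma,q')$ with $\sigma(q,q')\ne\emptyset$, and priorities $\mathrm{pri}(q,\sigma,q')=\mathrm{opt}\,\sigma(q,q')$. A flattened nested history tree (FNHT) in $\mathrm{fnht}(Q,\pi)$ is a tuple $(\mathcal T,l_s,l_l,l_p,l_r)$, where $\mathcal T$ is a non-empty, finite, prefix closed set of finite sequences over $\mathbb N\cup\{\mathfrak s\}$ and $l_s,l_p,l_r:\mathcal T\to 2^Q$, $l_l:\mathcal T\to 2\mathbb N$. The root $\varepsilon$ and the nodes $v\mathfrak s$ are called stepchildren, the nodes $vc$ with $c\in\mathbb N$ natural children (of $v$). The following is required. 1. Stepchildren have only natural children, and natural children have only stepchildren; every leaf is a natural child or, if $\pi$ is odd, possibly the root; if $c<c'$ and $vc'\in\mathcal T$, then $vc\in\mathcal T$. 2. $l_s(v)\neq\emptyset$ for all $v\in\mathcal T$. 3. If $v$ is a stepchild, then $l_p(v)=\emptyset$, and $l_s(v)$ is the disjoint union of $l_r(v)$ and the sets $l_s(v')$ for the natural children $v'$ of $v$. 4. If $v$ is a natural child, then $l_p(v)\ne\emptyset$,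 $l_s(v)$ is the disjoint union of $l_p(v)$ and $l_r(v)$, and $l_s(v\mathfrak s)=l_p(v)$ if $v$ is not a leaf. 5. $l_l(\varepsilon)=\pi_e$; $l_l(v)\ge 2$ for all $v\in\mathcal T$; $l_l(v\mathfrak s)=l_l(v)-2$ if $v\mathfrak s\in\mathcal T$; $l_l(vc)=l_l(v)$ if $vc\in\mathcal T$ with $c\in\mathbb N$. An FNHT is full if $l_s(\varepsilon)=Q$. **Theorem.** Every nondeterministic Büchi automaton $\mathcal B$ over $\Sigma$ that recognises the complement $\Sigma^\omega\smallsetminus\mathcal L(\mathcal P_n^\Pi)$ of the language of the full parity automaton has at least as many states as there are full FNHTs in $\mathrm{fnht}(Q,\max\Pi)$; in particular, there are only finitely many of the latter. -/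

import Mathlib

/-! ### Priorities -/

/-- Priority `i` is strictly better for acceptance than priority `j`. -/
def Better (i j : ℕ) : Prop :=
  (Even i ∧ Odd j) ∨ (Even i ∧ j < i) ∨ (Odd j ∧ i < j)

/-- The optimal priority of a finite set: its largest even element if it has an even element,
otherwise its least (odd) element; the value on the empty set is never used. -/
def opt (s : Finset ℕ) : ℕ :=
  if h : (s.filter Even).Nonempty then (s.filter Even).max' h
  else if h' : s.Nonempty then s.min' h' else 0

/-- `opt s` is the element of `s` that is at least as good as every element of `s`. -/
theorem opt_spec {s : Finset ℕ} (hs : s.Nonempty) :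
    opt s ∈ s ∧ ∀ j ∈ s, opt s = j ∨ Better (opt s) j := by
  unfold opt
  split_ifs with h
  · have hm := Finset.max'_mem _ h
    rw [Finset.mem_filter] at hm
    refine ⟨hm.1, fun j hj => ?_⟩
    rcases Nat.even_or_odd j with he | ho
    · have hle := Finset.le_max' (s.filter Even) j (Finset.mem_filter.2 ⟨hj, he⟩)
      rcases hle.lt_or_eq with hlt | heq
      · exact Or.inr (Or.inr (Or.inl ⟨hm.2, hlt⟩))
      · exact Or.inl heq.symm
    · exact Or.inr (Or.inl ⟨hm.2, ho⟩)
  · refine ⟨Finset.min'_mem _ hs, fun j hj => ?_⟩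
    have hodd : Odd j := by
      rcases Nat.even_or_odd j with he | ho
      · exact absurd ⟨j, Finset.mem_filter.2 ⟨hj, he⟩⟩ h
      · exact ho
    rcases (Finset.min'_le s j hj).lt_or_eq with hlt | heq
    · exact Or.inr (Or.inr (Or.inr ⟨hodd, hlt⟩))
    · exact Or.inl heq

/-! ### Automata on infinite words

Finiteness of the state set is required where the automata are used. -/

/-- Nondeterministic parity automata with states `Q`, alphabet `A`, and priorities `P` on the
transitions. Only the values of `pri` on members of `trans` matter. -/
structure ParityAutomaton (Q A : Type*) (P : Finset ℕ) where
  init : Set Q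
  init_nonempty : init.Nonempty
  trans : Set (Q × A × Q)
  pri : Q × A × Q → ℕ
  pri_mem : ∀ τ ∈ trans, pri τ ∈ P

namespace ParityAutomaton

variable {Q A : Type*} {P : Finset ℕ}

/-- `ρ` is a run on the infinite word `α`. -/
def IsRun (M : ParityAutomaton Q A P) (α : ℕ → A) (ρ : ℕ → Q) : Prop :=
  ρ 0 ∈ M.init ∧ ∀ i, (ρ i, α i, ρ (i + 1)) ∈ M.trans

/-- The highest priority that occurs infinitely often on the transitions of `ρ` is even. -/
def IsAccepting (M : ParityAutomaton Q A P) (α : ℕ → A) (ρ : ℕ → Q) : Prop :=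
  ∃ e, Even e ∧
    (∃ᶠ i in Filter.atTop, M.pri (ρ i, α i, ρ (i + 1)) = e) ∧
    (∀ᶠ i in Filter.atTop, M.pri (ρ i, α i, ρ (i + 1)) ≤ e)

/-- The language of a parity automaton. -/
def language (M : ParityAutomaton Q A P) : Set (ℕ → A) :=
  {α | ∃ ρ, M.IsRun α ρ ∧ M.IsAccepting α ρ}

end ParityAutomaton

/-- Nondeterministic Büchi automata with states `S`, alphabet `A`, and a set `final` of accepting
transitions. -/
structure BuchiAutomaton (S A : Type*) where
  init : Set S
  init_nonempty : init.Nonempty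
  trans : Set (S × A × S)
  final : Set (S × A × S)
  final_subset : final ⊆ trans

namespace BuchiAutomaton

variable {S A : Type*}

/-- `ρ` is a run on the infinite word `α`. -/
def IsRun (B : BuchiAutomaton S A) (α : ℕ → A) (ρ : ℕ → S) : Prop :=
  ρ 0 ∈ B.init ∧ ∀ i, (ρ i, α i, ρ (i + 1)) ∈ B.trans

/-- `ρ` takes accepting transitions infinitely often. -/
def IsAccepting (B : BuchiAutomaton S A) (α : ℕ → A) (ρ : ℕ → S) : Prop :=
  ∃ᶠ i in Filter.atTop, (ρ i, α i, ρ (i + 1)) ∈ B.final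

/-- The language of a Büchi automaton. -/
def language (B : BuchiAutomaton S A) : Set (ℕ → A) :=
  {α | ∃ ρ, B.IsRun α ρ ∧ B.IsAccepting α ρ}

end BuchiAutomaton

/-! ### The full parity automaton -/

/-- The letters of the full automaton: all functions from `Q × Q` to the subsets of `P`. -/
abbrev Letter (Q : Type*) (P : Finset ℕ) : Type _ := Q × Q → P.powerset

/-- The full parity automaton with states `Q` and priorities `P`. -/
def fullParity (Q : Type*) [Nonempty Q] (P : Finset ℕ) :
    ParityAutomaton Q (Letter Q P) P where
  init := Set.univ
  init_nonempty := Set.univ_nonempty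
  trans := {τ | ((τ.2.1 (τ.1, τ.2.2) : Finset ℕ)).Nonempty}
  pri := fun τ => opt (τ.2.1 (τ.1, τ.2.2) : Finset ℕ)
  pri_mem := fun τ hτ =>
    Finset.mem_powerset.1 (τ.2.1 (τ.1, τ.2.2)).2 (opt_spec hτ).1

/-! ### Flattened nested history trees -/

/-- The symbols of tree addresses: the natural numbers and the stepchild symbol. -/
inductive Dir : Type
  | step : Dir
  | nat (c : ℕ) : Dir

/-- An address of a stepchild; the root counts as a stepchild. -/
def IsStepchild (v : List Dir) : Prop := v = [] ∨ ∃ u, v = u ++ [Dir.step]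

/-- An address of a natural child. -/
def IsNaturalChild (v : List Dir) : Prop := ∃ u c, v = u ++ [Dir.nat c]

/-- The largest even number that is at most `π`. -/
def maxEven (π : ℕ) : ℕ := 2 * (π / 2)

/-- Flattened nested history trees over the states `Q` with maximal priority `π`.
The labelling functions `ls` (states), `ll` (level), `lp` (pure states) and `lr` (recurrent states)
live on the tree only; they are represented by functions on all addresses that have a fixed default
value outside the tree, so that two trees are equal iff they have the same nodes and labels. -/
@[ext]
structure FNHT (Q : Type*) (π : ℕ) where
  tree : Finset (List Dir)
  ls : List Dir → Set Q
  ll : List Dir → ℕ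
  lp : List Dir → Set Q
  lr : List Dir → Set Q
  ls_default : ∀ v, v ∉ tree → ls v = ∅
  ll_default : ∀ v, v ∉ tree → ll v = 0
  lp_default : ∀ v, v ∉ tree → lp v = ∅
  lr_default : ∀ v, v ∉ tree → lr v = ∅
  nonempty : tree.Nonempty
  prefix_closed : ∀ v x, v ++ [x] ∈ tree → v ∈ tree
  stepchild_children : ∀ v, IsStepchild v → v ++ [Dir.step] ∉ tree
  natural_children : ∀ v c, IsNaturalChild v → v ++ [Dir.nat c] ∉ tree
  leaf : ∀ v ∈ tree, (∀ x, v ++ [x] ∉ tree) → IsNaturalChild v ∨ (v = [] ∧ Odd π)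
  order_closed : ∀ v c c', c < c' → v ++ [Dir.nat c'] ∈ tree → v ++ [Dir.nat c] ∈ tree
  ls_nonempty : ∀ v ∈ tree, (ls v).Nonempty
  stepchild_lp : ∀ v ∈ tree, IsStepchild v → lp v = ∅
  stepchild_ls : ∀ v ∈ tree, IsStepchild v →
    ls v = lr v ∪ ⋃ c ∈ {c : ℕ | v ++ [Dir.nat c] ∈ tree}, ls (v ++ [Dir.nat c])
  stepchild_disjoint : ∀ v ∈ tree, IsStepchild v → ∀ c c', c ≠ c' →
    v ++ [Dir.nat c] ∈ tree → v ++ [Dir.nat c'] ∈ tree →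
    Disjoint (ls (v ++ [Dir.nat c])) (ls (v ++ [Dir.nat c']))
  stepchild_lr_disjoint : ∀ v ∈ tree, IsStepchild v →
    Disjoint (lr v) (⋃ c ∈ {c : ℕ | v ++ [Dir.nat c] ∈ tree}, ls (v ++ [Dir.nat c]))
  natural_lp_nonempty : ∀ v ∈ tree, IsNaturalChild v → (lp v).Nonempty
  natural_ls : ∀ v ∈ tree, IsNaturalChild v → ls v = lp v ∪ lr v
  natural_disjoint : ∀ v ∈ tree, IsNaturalChild v → Disjoint (lp v) (lr v)
  natural_step : ∀ v, IsNaturalChild v → v ++ [Dir.step] ∈ tree → ls (v ++ [Dir.step]) = lp v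
  ll_even : ∀ v, Even (ll v)
  ll_root : ll [] = maxEven π
  two_le_ll : ∀ v ∈ tree, 2 ≤ ll v
  ll_step : ∀ v, v ++ [Dir.step] ∈ tree → ll (v ++ [Dir.step]) + 2 = ll v
  ll_nat : ∀ v c, v ++ [Dir.nat c] ∈ tree → ll (v ++ [Dir.nat c]) = ll v

/-- A flattened nested history tree is full if its root carries all states. -/
def FNHT.IsFull {Q : Type*} {π : ℕ} (t : FNHT Q π) : Prop := t.ls [] = Set.univ

/-! A full tree is encoded by its rank function `f`, the position of each state at each depth; depth
`d` belongs to the even level `e = 2 * (π / 2) - 2 * d`. Two letters arise from `f`. Both let a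
state drop to a lower position with priority `e` and move within a pure class with priority `e - 1`;
the weak letter also lets it stay in a recurrent class with priority `e`. A run with even limit
superior eventually has constant position at depth `d`. If the strict letter occurs infinitely
often, this position is pure, which pushes the run one depth further, until the levels run out
(`not_even_limsup`).

Hence `B` accepts the word that repeats a block of `Fintype.card S` weak letters and one strict
letter. By pigeonhole, some state of `B` lies on an accepting loop over both letters and on a loop
over the weak letter alone (`exists_recurs`). If `f` and `g` shared such a state, `B` would accept
lassos that mix an accepting loop of `f` with a weak loop of `g`. If `f ≠ g`, such a mixture, in one
of the two orders, lets the parity automaton cycle with even maximal priority: words of `f` lead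
down from `x` to `y` and those of `g` back, or a state is pure for `f` and recurrent for `g`
(`mixedCycle_of_ne`). So states of `B` chosen for different rank functions differ, and the rank
function determines a full tree (`FNHT.eq_of_rank_eq`).

For even `π`, a topmost recurrent class cannot be entered from outside and is left at a strict
letter, so a cycle through it could not be joined to a prefix. Its states are the dead ones: the
initial letter removes them and the later letters do not restrict them. This forces rank functions
that share a state of `B` to have the same dead states (`RankState.dead_imp`). -/

/-! ### Finite walks and lassos -/

/-- A finite walk reading a list of letters, all of whose priorities are at most `e`. -/
inductive Walk {S A : Type*} (T : S → A → ℕ → S → Prop) (e : ℕ) : S → List A → S → Prop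
  | nil (s : S) : Walk T e s [] s
  | cons {s s' s'' : S} {a : A} {j : ℕ} {u : List A} :
      T s a j s' → j ≤ e → Walk T e s' u s'' → Walk T e s (a :: u) s''

/-- A finite walk whose maximal priority is exactly `e`. -/
def HitWalk {S A : Type*} (T : S → A → ℕ → S → Prop) (e : ℕ) (s : S) (u : List A) (s' : S) : Prop :=
  ∃ u₁ a u₂ x y, u = u₁ ++ a :: u₂ ∧ Walk T e s u₁ x ∧ T x a e y ∧ Walk T e y u₂ s'

/-- The infinite word that reads `pre` and then repeats `u` forever. -/
def lasso {A : Type*} (a₀ : A) (pre u : List A) (i : ℕ) : A :=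
  if i < pre.length then pre.getD i a₀ else u.getD ((i - pre.length) % u.length) a₀

section Walks

variable {S A : Type*} {T : S → A → ℕ → S → Prop} {e : ℕ} {s s' s'' : S} {u v : List A}

theorem Walk.append (h : Walk T e s u s') (h' : Walk T e s' v s'') : Walk T e s (u ++ v) s'' := by
  induction h with
  | nil => exact h'
  | cons hT hj _ ih => exact .cons hT hj (ih h')

theorem Walk.loop (h : ∀ a ∈ u, ∃ j ≤ e, T s a j s) : Walk T e s u s := by
  induction u with
  | nil => exact .nil s
  | cons a u ih =>
    obtain ⟨j, hj, hT⟩ := h a (by simp)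
    exact .cons hT hj (ih fun b hb => h b (by simp [hb]))

theorem HitWalk.append (h : HitWalk T e s u s') (h' : Walk T e s' v s'') :
    HitWalk T e s (u ++ v) s'' := by
  obtain ⟨u₁, a, u₂, x, y, rfl, h₁, hT, h₂⟩ := h
  exact ⟨u₁, a, u₂ ++ v, x, y, by simp, h₁, hT, h₂.append h'⟩

theorem Walk.append_hit (h : Walk T e s u s') (h' : HitWalk T e s' v s'') :
    HitWalk T e s (u ++ v) s'' := by
  obtain ⟨u₁, a, u₂, x, y, rfl, h₁, hT, h₂⟩ := h'
  exact ⟨u ++ u₁, a, u₂, x, y, by simp, h.append h₁, hT, h₂⟩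

theorem HitWalk.ne_nil (h : HitWalk T e s u s') : u ≠ [] := by
  obtain ⟨u₁, a, u₂, x, y, rfl, -⟩ := h
  simp

/-- `ρ` and `pr` list the states and the priorities of a walk. -/
def Traces (T : S → A → ℕ → S → Prop) (e : ℕ) (s : S) (u : List A) (s' : S)
    (ρ : ℕ → S) (pr : ℕ → ℕ) : Prop :=
  ρ 0 = s ∧ ρ u.length = s' ∧
    ∀ i a, u[i]? = some a → T (ρ i) a (pr i) (ρ (i + 1)) ∧ pr i ≤ e

theorem Traces.cons {ρ : ℕ → S} {pr : ℕ → ℕ} {a : A} {j : ℕ} (h : Traces T e s' u s'' ρ pr)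
    (hT : T s a j s') (hj : j ≤ e) :
    Traces T e s (a :: u) s'' (fun i => Nat.casesOn i s ρ) (fun i => Nat.casesOn i j pr) := by
  obtain ⟨h0, h1, h2⟩ := h
  refine ⟨rfl, h1, fun i b hb => ?_⟩
  cases i with
  | zero =>
    obtain rfl : a = b := by simpa using hb
    exact ⟨by simpa [h0] using hT, hj⟩
  | succ i => exact h2 i b (by simpa using hb)

theorem Walk.exists_traces (h : Walk T e s u s') : ∃ ρ pr, Traces T e s u s' ρ pr := by
  induction h with
  | nil s => exact ⟨fun _ => s, fun _ => 0, rfl, rfl, by simp⟩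
  | cons hT hj _ ih =>
    obtain ⟨ρ, pr, h⟩ := ih
    exact ⟨_, _, h.cons hT hj⟩

theorem HitWalk.exists_traces (h : HitWalk T e s u s') :
    ∃ ρ pr, Traces T e s u s' ρ pr ∧ ∃ i < u.length, pr i = e := by
  obtain ⟨u₁, a, u₂, x, y, rfl, h₁, hT, h₂⟩ := h
  induction h₁ with
  | nil s =>
    obtain ⟨ρ, pr, h⟩ := h₂.exists_traces
    exact ⟨_, _, h.cons hT le_rfl, 0, by simp, rfl⟩
  | cons hT' hj _ ih =>
    obtain ⟨ρ, pr, h, i, hi, hp⟩ := ih hT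
    exact ⟨_, _, h.cons hT' hj, i + 1, by simpa using hi, hp⟩

/-- The relation `T` is arbitrary so that both kinds of automata are covered; Büchi acceptance is
the case of maximal priority `1`. -/
theorem exists_lasso_run (a₀ : A) {e₀ : ℕ} {s₀ : S} {pre : List A}
    (hpre : Walk T e₀ s₀ pre s) (hu : HitWalk T e s u s) :
    ∃ (ρ : ℕ → S) (pr : ℕ → ℕ), ρ 0 = s₀ ∧
      (∀ i, T (ρ i) (lasso a₀ pre u i) (pr i) (ρ (i + 1))) ∧
      (∃ᶠ i in Filter.atTop, pr i = e) ∧ ∀ᶠ i in Filter.atTop, pr i ≤ e := by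
  obtain ⟨ρ₁, p₁, h10, h1n, h1⟩ := hpre.exists_traces
  obtain ⟨ρ₂, p₂, ⟨h20, h2m, h2⟩, k₀, hk₀, hpk₀⟩ := hu.exists_traces
  set n := pre.length with hn
  set m := u.length with hm
  have hmpos : 0 < m := by omega
  refine ⟨fun i => if i < n then ρ₁ i else ρ₂ ((i - n) % m),
    fun i => if i < n then p₁ i else p₂ ((i - n) % m), ?_, fun i => ?_, ?_, ?_⟩
  · by_cases h : 0 < n
    · simp [h, h10]
    · have : n = 0 := by omega
      simp only [this, lt_irrefl, if_false, Nat.sub_zero, Nat.zero_mod, h20]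
      rw [← h10, ← h1n, this]
  · unfold lasso
    rw [← hn, ← hm]
    by_cases hi : i < n
    · have hi₀ : i < pre.length := hi
      have hstep := (h1 i pre[i] (by simp)).1
      have hget : pre.getD i a₀ = pre[i] := by simp [hi₀]
      simp only [hi, if_true, hget]
      by_cases hi' : i + 1 < n
      · simpa [hi'] using hstep
      · have : i + 1 = n := by omega
        simp only [this, lt_irrefl, if_false, Nat.sub_self, Nat.zero_mod, h20]
        rw [this, h1n] at hstep
        exact hstep
    · have hi' : ¬ i + 1 < n := by omega
      have hlt : (i - n) % m < m := Nat.mod_lt _ hmpos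
      have hlt' : (i - n) % m < u.length := hlt
      have hstep := (h2 ((i - n) % m) u[(i - n) % m] (by simp [hlt'])).1
      have hget : u.getD ((i - n) % m) a₀ = u[(i - n) % m] := by simp [hlt']
      simp only [hi, hi', if_false, hget]
      have hsub : i + 1 - n = (i - n) + 1 := by omega
      rw [hsub]
      by_cases hc : (i - n) % m + 1 = m
      · have : ((i - n) + 1) % m = 0 := by
          rw [← Nat.mod_add_mod, hc, Nat.mod_self]
        rw [this, h20]
        rw [hc, h2m] at hstep
        exact hstep
      · have : ((i - n) + 1) % m = (i - n) % m + 1 := by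
          rw [← Nat.mod_add_mod, Nat.mod_eq_of_lt (by omega)]
        rw [this]
        exact hstep
  · rw [Filter.frequently_atTop]
    intro N
    refine ⟨n + (m * N + k₀), by nlinarith, ?_⟩
    have : ¬ n + (m * N + k₀) < n := by omega
    simp only [this, if_false, Nat.add_sub_cancel_left, Nat.mul_add_mod, Nat.mod_eq_of_lt hk₀,
      hpk₀]
  · filter_upwards [Filter.eventually_ge_atTop n] with i hi
    have hi' : ¬ i < n := by omega
    have hlt' : (i - n) % m < u.length := Nat.mod_lt _ hmpos
    simp only [hi', if_false]
    exact (h2 ((i - n) % m) u[(i - n) % m] (by simp [hlt'])).2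

end Walks

/-! ### Acceptance of lassos -/

/-- The transitions of a Büchi automaton, with priority `1` reserved for accepting ones. -/
def BuchiAutomaton.Step {S A : Type*} (B : BuchiAutomaton S A) (s : S) (a : A) (j : ℕ) (s' : S) :
    Prop :=
  (s, a, s') ∈ B.trans ∧ (j = 1 → (s, a, s') ∈ B.final)

/-- The transitions of the full parity automaton, with any of the available priorities. -/
def FullStep {Q : Type*} {P : Finset ℕ} (q : Q) (a : Letter Q P) (j : ℕ) (q' : Q) : Prop :=
  j ∈ (a (q, q') : Finset ℕ)

theorem BuchiAutomaton.lasso_mem_language {S A : Type*} {B : BuchiAutomaton S A} (a₀ : A)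
    {s₀ s : S} {pre u : List A} (hs₀ : s₀ ∈ B.init) (hpre : Walk B.Step 1 s₀ pre s)
    (hu : HitWalk B.Step 1 s u s) : lasso a₀ pre u ∈ B.language := by
  obtain ⟨ρ, pr, h0, hstep, hfr, -⟩ := exists_lasso_run a₀ hpre hu
  exact ⟨ρ, ⟨h0 ▸ hs₀, fun i => (hstep i).1⟩, hfr.mono fun i hi => (hstep i).2 hi⟩

/-- Replacing each priority by the optimal one of its letter entry cannot destroy acceptance. This
permits walks to use any available priority. -/
theorem mem_language_fullParity {Q : Type*} [Nonempty Q] {P : Finset ℕ} {α : ℕ → Letter Q P}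
    {ρ : ℕ → Q} {pr : ℕ → ℕ} {e : ℕ} (he : Even e)
    (hstep : ∀ i, FullStep (ρ i) (α i) (pr i) (ρ (i + 1)))
    (hfr : ∃ᶠ i in Filter.atTop, pr i = e) (hev : ∀ᶠ i in Filter.atTop, pr i ≤ e) :
    α ∈ (fullParity Q P).language := by
  classical
  set p : ℕ → ℕ := fun i => opt (α i (ρ i, ρ (i + 1)) : Finset ℕ) with hp
  have hne : ∀ i, ((α i (ρ i, ρ (i + 1)) : Finset ℕ)).Nonempty := fun i => ⟨_, hstep i⟩
  have hpP : ∀ i, p i ∈ P := fun i =>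
    Finset.mem_powerset.1 (α i (ρ i, ρ (i + 1))).2 (opt_spec (hne i)).1
  have hbest : ∀ i, p i = pr i ∨ Better (p i) (pr i) := fun i => (opt_spec (hne i)).2 _ (hstep i)
  have hgood : ∃ᶠ i in Filter.atTop, ∃ v ∈ P.filter (e ≤ ·), p i = v := by
    refine hfr.mono fun i hi => ⟨p i, Finset.mem_filter.2 ⟨hpP i, ?_⟩, rfl⟩
    rcases hbest i with h | h | h | h
    · omega
    · exact absurd h.2 (by rw [hi]; exact Nat.not_odd_iff_even.2 he)
    · omega
    · exact absurd h.1 (by rw [hi]; exact Nat.not_odd_iff_even.2 he)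
  -- The optimal priorities may exceed `e` infinitely often; their limit superior is the maximum of
  -- `V`.
  set V := (P.filter fun v => e ≤ v ∧ ∃ᶠ i in Filter.atTop, p i = v) with hV
  have hVne : V.Nonempty := by
    by_contra hcon
    refine hgood ?_
    have : ∀ v ∈ P.filter (e ≤ ·), ∀ᶠ i in Filter.atTop, ¬ p i = v := by
      intro v hv
      by_contra hv'
      rw [Finset.mem_filter] at hv
      exact hcon ⟨v, Finset.mem_filter.2 ⟨hv.1, hv.2, hv'⟩⟩
    filter_upwards [(Filter.eventually_all_finset _).2 this] with i hi
    rintro ⟨v, hv, hpv⟩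
    exact hi v hv hpv
  obtain ⟨e', he'V, hmax⟩ := Finset.exists_max_image V id hVne
  rw [hV, Finset.mem_filter] at he'V
  obtain ⟨he'P, hee', hfr'⟩ := he'V
  refine ⟨ρ, ⟨Set.mem_univ _, hne⟩, e', ?_, hfr', ?_⟩
  -- An odd `e'` would exceed `e`, but an odd priority is only better than larger odd ones, whereas
  -- `pr i ≤ e`.
  · obtain ⟨i, hi, hi'⟩ := (hfr'.and_eventually hev).exists
    by_contra hodd
    rw [Nat.not_even_iff_odd] at hodd
    have hne' : e' ≠ e := by
      rintro rfl
      exact Nat.not_even_iff_odd.2 hodd he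
    rcases hbest i with h | h | h | h
    · omega
    · exact Nat.not_even_iff_odd.2 hodd (hi ▸ h.1)
    · exact Nat.not_even_iff_odd.2 hodd (hi ▸ h.1)
    · have := h.2
      omega
  · have : ∀ v ∈ P.filter (e' < ·), ∀ᶠ i in Filter.atTop, ¬ p i = v := by
      intro v hv
      by_contra hv'
      rw [Finset.mem_filter] at hv
      have := hmax v (Finset.mem_filter.2 ⟨hv.1, by omega, hv'⟩)
      simp only [id] at this
      omega
    filter_upwards [(Filter.eventually_all_finset _).2 this] with i hi
    by_contra hlt
    exact hi (p i) (Finset.mem_filter.2 ⟨hpP i, not_le.1 hlt⟩) rfl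

theorem lasso_mem_language_fullParity {Q : Type*} [Nonempty Q] {P : Finset ℕ} (a₀ : Letter Q P)
    {q₀ q : Q} {pre u : List (Letter Q P)} {e₀ e : ℕ} (he : Even e)
    (hpre : Walk FullStep e₀ q₀ pre q) (hu : HitWalk FullStep e q u q) :
    lasso a₀ pre u ∈ (fullParity Q P).language := by
  obtain ⟨ρ, pr, -, hstep, hfr, hev⟩ := exists_lasso_run a₀ hpre hu
  exact mem_language_fullParity he hstep hfr hev

/-! ### Rank functions

A rank function assigns to a state its positions in the stepchildren of a flattened nested history
tree that contain it: `0` for the recurrent states of the stepchild itself, `2 * c + 1` for the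
pure states and `2 * c + 2` for the recurrent states of its `c`-th natural child. -/

section Ranks

variable {Q : Type*} {P : Finset ℕ} {π : ℕ} {f g : Q → ℕ → ℕ}

/-- The properties of the position functions of history trees. -/
structure IsRank (π : ℕ) (f : Q → ℕ → ℕ) : Prop where
  zero_of_even : ∀ q i j, Even (f q i) → i < j → f q j = 0
  zero_of_le : ∀ q d, π / 2 ≤ d → f q d = 0
  tight : ∀ q d c, Odd c → c ≤ f q d → ∃ x, (∀ i < d, f x i = f q i) ∧ f x d = c

/-- `x` and `y` lie in the same pure classes above depth `d`. -/
def Agree (f : Q → ℕ → ℕ) (d : ℕ) (x y : Q) : Prop := ∀ i < d, f x i = f y i ∧ Odd (f x i)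

/-- A transition from `q` to `q'` with priority `j` is compatible with the rank function `f`; if `b`
holds, then it may also stay within a class of recurrent states. -/
def Allowed (π : ℕ) (f : Q → ℕ → ℕ) (b : Prop) (q : Q) (j : ℕ) (q' : Q) : Prop :=
  -- The first alternative is the odd priority just above the level of depth `d`; for even `π` and
  -- `d = 0` it is `π + 1`, which is not available.
  ∃ d, Agree f d q q' ∧ (j + 2 * d = 2 * (π / 2) + 1 ∨
    j + 2 * d ≤ 2 * (π / 2) ∧ (f q' d < f q d ∨ b ∧ f q' d = f q d ∧ Even (f q d)))

/-- The states of the topmost class, if it is a class of recurrent states that can only be left. -/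
def Dead (π : ℕ) (f : Q → ℕ → ℕ) (q : Q) : Prop :=
  Even π ∧ Even (f q 0) ∧ ∀ x, f x 0 ≤ f q 0

open Classical in
/-- The letter with the transitions and priorities described by `R`. -/
noncomputable def letterOf (P : Finset ℕ) (R : Q → ℕ → Q → Prop) : Letter Q P :=
  fun x => ⟨P.filter (R x.1 · x.2), Finset.mem_powerset.2 (Finset.filter_subset _ _)⟩

/-- The letter of all transitions compatible with `f`; dead states are not restricted. -/
noncomputable def rankLetter (P : Finset ℕ) (π : ℕ) (f : Q → ℕ → ℕ) (b : Prop) : Letter Q P :=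
  letterOf P fun q j q' => Dead π f q ∨ Allowed π f b q j q'

/-- The letter that removes the dead states. -/
noncomputable def killLetter (P : Finset ℕ) (π : ℕ) (f : Q → ℕ → ℕ) : Letter Q P :=
  letterOf P fun q j q' => ¬ Dead π f q ∧ q = q' ∧ j = 1

/-- The two letters of a rank function. -/
def IsRankLetter (P : Finset ℕ) (π : ℕ) (f : Q → ℕ → ℕ) (a : Letter Q P) : Prop :=
  a = rankLetter P π f True ∨ a = rankLetter P π f False

theorem fullStep_letterOf {R : Q → ℕ → Q → Prop} {q q' : Q} {j : ℕ} :
    FullStep q (letterOf P R) j q' ↔ j ∈ P ∧ R q j q' := by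
  simp [FullStep, letterOf]

theorem Agree.refl_of {d : ℕ} {x y : Q} (h : Agree f d x y) : Agree f d x x :=
  fun i hi => ⟨rfl, (h i hi).2⟩

theorem Agree.symm {d : ℕ} {x y : Q} (h : Agree f d x y) : Agree f d y x :=
  fun i hi => ⟨(h i hi).1.symm, (h i hi).1 ▸ (h i hi).2⟩

theorem Agree.trans {d : ℕ} {x y z : Q} (h : Agree f d x y) (h' : Agree f d y z) :
    Agree f d x z :=
  fun i hi => ⟨(h i hi).1.trans (h' i hi).1, (h i hi).2⟩

theorem Agree.succ {d : ℕ} {x y : Q} (h : Agree f d x y) (hd : f x d = f y d)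
    (hodd : Odd (f x d)) : Agree f (d + 1) x y := by
  intro i hi
  rcases Nat.lt_succ_iff_lt_or_eq.1 hi with h' | rfl
  · exact h i h'
  · exact ⟨hd, hodd⟩

theorem Allowed.mono {b : Prop} {q q' : Q} {j : ℕ} (h : Allowed π f b q j q') :
    Allowed π f True q j q' := by
  obtain ⟨d, hd, h | ⟨h, h' | h'⟩⟩ := h
  · exact ⟨d, hd, .inl h⟩
  · exact ⟨d, hd, .inr ⟨h, .inl h'⟩⟩
  · exact ⟨d, hd, .inr ⟨h, .inr ⟨trivial, h'.2⟩⟩⟩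

/-! #### The words of a rank function are rejected -/

theorem Allowed.not_dead {b : Prop} {q q' : Q} {j : ℕ} (h : Allowed π f b q j q') (hj : j ≤ π)
    (hq : ¬ Dead π f q) : ¬ Dead π f q' := by
  rintro ⟨hπ, he, hmax⟩
  obtain ⟨d, hd, h⟩ := h
  have h2 : 2 * (π / 2) = π := Nat.two_mul_div_two_of_even hπ
  rcases Nat.eq_zero_or_pos d with rfl | hpos
  · rcases h with h | ⟨-, h | h⟩
    · omega
    · exact absurd (hmax q) (not_le.2 h)
    · exact hq ⟨hπ, h.2.2, fun x => h.2.1 ▸ hmax x⟩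
  · have := hd 0 hpos
    exact Nat.not_even_iff_odd.2 this.2 (this.1 ▸ he)

theorem eventually_const_of_antitone {h : ℕ → ℕ}
    (hh : ∀ᶠ i in Filter.atTop, h (i + 1) ≤ h i) : ∃ c, ∀ᶠ i in Filter.atTop, h i = c := by
  obtain ⟨N, hN⟩ := Filter.eventually_atTop.1 hh
  have hanti : Antitone fun i => h (N + i) :=
    antitone_nat_of_succ_le fun i => hN (N + i) (by omega)
  obtain ⟨i, hi⟩ : ∃ i, ∀ j, h (N + i) ≤ h (N + j) := by
    obtain ⟨i, hi⟩ := exists_minimal_of_wellFoundedLT (fun c => ∃ i, h (N + i) = c) ⟨_, 0, rfl⟩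
    obtain ⟨⟨i, rfl⟩, hi⟩ := hi
    refine ⟨i, fun j => ?_⟩
    by_contra hlt
    exact hlt (hi ⟨j, rfl⟩ (le_of_lt (not_le.1 hlt)))
  refine ⟨h (N + i), Filter.eventually_atTop.2 ⟨N + i, fun k hk => ?_⟩⟩
  obtain ⟨k, rfl⟩ := Nat.exists_eq_add_of_le (show N ≤ k by omega)
  exact le_antisymm (hanti (show i ≤ k by omega)) (hi k)

/-- The limit superior of the priorities of transitions compatible with `f` is not even, if
infinitely many of the transitions do not stay within a class of recurrent states. -/
theorem not_even_limsup {ρ : ℕ → Q} {pr : ℕ → ℕ} {e : ℕ} (he : Even e) (heπ : e ≤ π)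
    (hA : ∀ᶠ i in Filter.atTop, Allowed π f True (ρ i) (pr i) (ρ (i + 1)))
    (hS : ∃ᶠ i in Filter.atTop, Allowed π f False (ρ i) (pr i) (ρ (i + 1)))
    (hfr : ∃ᶠ i in Filter.atTop, pr i = e) (hev : ∀ᶠ i in Filter.atTop, pr i ≤ e) : False := by
  -- Each depth lowers the bound on `e` by two, so depth `π / 2 + 1` is contradictory.
  have key : ∀ d, e + 2 * d ≤ 2 * (π / 2) ∧
      ∀ᶠ i in Filter.atTop, Agree f d (ρ i) (ρ (i + 1)) := by
    intro d
    induction d with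
    | zero =>
      obtain ⟨k, rfl⟩ := he
      exact ⟨by omega, Filter.Eventually.of_forall fun i j hj => absurd hj (Nat.not_lt_zero _)⟩
    | succ d ih =>
      obtain ⟨hed, hag⟩ := ih
      -- A witness above depth `d` is excluded by the agreement in odd positions and by `pr i ≤ e`;
      -- the latter also excludes the odd priority at depth `d` itself.
      have deep : ∀ᶠ i in Filter.atTop, ∀ b, Allowed π f b (ρ i) (pr i) (ρ (i + 1)) →
          (f (ρ (i + 1)) d < f (ρ i) d ∨
            b ∧ f (ρ (i + 1)) d = f (ρ i) d ∧ Even (f (ρ i) d)) ∨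
          (pr i + 2 * (d + 1) ≤ 2 * (π / 2) + 1 ∧ Agree f (d + 1) (ρ i) (ρ (i + 1))) := by
        filter_upwards [hag, hev] with i hag hle b ⟨d', hd', h⟩
        rcases lt_trichotomy d' d with hlt | rfl | hgt
        · obtain ⟨h1, h2⟩ := hag d' hlt
          rcases h with h | ⟨-, h | h⟩
          · omega
          · omega
          · exact absurd h.2.2 (Nat.not_even_iff_odd.2 h2)
        · rcases h with h | ⟨-, h⟩
          · omega
          · exact .inl h
        · refine .inr ⟨by rcases h with h | h <;> omega, fun i hi => hd' i (by omega)⟩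
      obtain ⟨c, hc⟩ := eventually_const_of_antitone (h := fun i => f (ρ i) d) (by
        filter_upwards [deep, hA] with i h hA
        rcases h True hA with (h | h) | h
        · exact h.le
        · exact h.2.1.le
        · exact (h.2 d (Nat.lt_succ_self d)).1.ge)
      have hc' := (Filter.tendsto_add_atTop_nat 1).eventually hc
      -- A strict transition that keeps the position at depth `d` must have a deeper witness, so the
      -- position is odd.
      have hcodd : Odd c := by
        obtain ⟨i, hi, h1, h2, h3⟩ := (hS.and_eventually (deep.and (hc.and hc'))).exists
        rcases h1 False hi with (h | h) | h
        · omega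
        · exact h.1.elim
        · exact h2 ▸ (h.2 d (Nat.lt_succ_self d)).2
      have hnext : ∀ᶠ i in Filter.atTop, pr i + 2 * (d + 1) ≤ 2 * (π / 2) + 1 ∧
          Agree f (d + 1) (ρ i) (ρ (i + 1)) := by
        filter_upwards [deep, hA, hc, hc'] with i h hA h2 h3
        rcases h True hA with (h | h) | h
        · omega
        · exact absurd h.2.2 (Nat.not_even_iff_odd.2 (h2 ▸ hcodd))
        · exact h
      refine ⟨?_, hnext.mono fun i h => h.2⟩
      obtain ⟨i, hi, h⟩ := (hfr.and_eventually hnext).exists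
      obtain ⟨k, rfl⟩ := he
      omega
  have := (key (π / 2 + 1)).1
  omega

theorem not_mem_language_of_rank [Nonempty Q] (hP : ∀ j ∈ P, j ≤ π) {α : ℕ → Letter Q P}
    (h0 : α 0 = killLetter P π f) (hα : ∀ i, 1 ≤ i → IsRankLetter P π f (α i))
    (hfr : ∃ᶠ i in Filter.atTop, α i = rankLetter P π f False) :
    α ∉ (fullParity Q P).language := by
  rintro ⟨ρ, ⟨-, hrun⟩, e, he, hfre, heve⟩
  have hmem : ∀ i, FullStep (ρ i) (α i) ((fullParity Q P).pri (ρ i, α i, ρ (i + 1))) (ρ (i + 1)) :=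
    fun i => (opt_spec (hrun i)).1
  set pr := fun i => (fullParity Q P).pri (ρ i, α i, ρ (i + 1)) with hpr
  have hprP : ∀ i, pr i ∈ P := fun i => (fullParity Q P).pri_mem _ (hrun i)
  have hstep : ∀ b i, α i = rankLetter P π f b → ¬ Dead π f (ρ i) →
      Allowed π f b (ρ i) (pr i) (ρ (i + 1)) := by
    intro b i hi hdead
    have hmem' : FullStep (ρ i) (α i) (pr i) (ρ (i + 1)) := hmem i
    generalize pr i = j at hmem' ⊢
    rw [hi, rankLetter, fullStep_letterOf] at hmem'
    exact hmem'.2.resolve_left hdead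
  have hlive : ∀ i, ¬ Dead π f (ρ (i + 1)) := by
    intro i
    induction i with
    | zero =>
      have := hmem 0
      rw [h0, killLetter, fullStep_letterOf] at this
      exact this.2.2.1 ▸ this.2.1
    | succ i ih =>
      rcases hα (i + 1) (by omega) with h | h
      · exact (hstep _ _ h ih).not_dead (hP _ (hprP _)) ih
      · exact (hstep _ _ h ih).not_dead (hP _ (hprP _)) ih
  have hlive' : ∀ᶠ i in Filter.atTop, 1 ≤ i ∧ ¬ Dead π f (ρ i) := by
    filter_upwards [Filter.eventually_ge_atTop 1] with i hi
    obtain ⟨k, rfl⟩ := Nat.exists_eq_add_of_le' hi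
    exact ⟨hi, hlive k⟩
  refine not_even_limsup (π := π) (f := f) (ρ := ρ) (pr := pr) he ?_ ?_ ?_ hfre heve
  · obtain ⟨i, hi⟩ := hfre.exists
    exact hi ▸ hP _ (hprP i)
  · filter_upwards [hlive'] with i hi
    rcases hα i hi.1 with h | h
    · exact hstep _ _ h hi.2
    · exact (hstep _ _ h hi.2).mono
  · exact (hfr.and_eventually hlive').mono fun i hi => hstep _ _ hi.1 hi.2.2

/-! #### Mixing the words of two rank functions -/

theorem fullStep_down (hP : ∀ j, 1 ≤ j → j ≤ π → j ∈ P) {d e : ℕ} (he : e + 2 * d = 2 * (π / 2))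
    (he2 : 2 ≤ e) {x y : Q} (h : Agree f d x y) (hlt : f y d < f x d) {a : Letter Q P}
    (ha : IsRankLetter P π f a) : FullStep x a e y := by
  rcases ha with rfl | rfl <;>
  exact fullStep_letterOf.2 ⟨hP _ (by omega) (by omega), .inr ⟨d, h, .inr ⟨he.le, .inl hlt⟩⟩⟩

/-- States in one pure class agree to depth `d + 1`, where the odd priority above the level is `e -
1`. -/
theorem fullStep_flat (hP : ∀ j, 1 ≤ j → j ≤ π → j ∈ P) {d e : ℕ} (he : e + 2 * d = 2 * (π / 2))
    (he2 : 2 ≤ e) {x y : Q} (h : Agree f d x y) (heq : f x d = f y d) (hodd : Odd (f x d))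
    {a : Letter Q P} (ha : IsRankLetter P π f a) : FullStep x a (e - 1) y := by
  rcases ha with rfl | rfl <;>
  exact fullStep_letterOf.2 ⟨hP _ (by omega) (by omega), .inr
    ⟨d + 1, h.succ heq hodd, .inl (by omega)⟩⟩

theorem fullStep_stay (hP : ∀ j, 1 ≤ j → j ≤ π → j ∈ P) {d e : ℕ} (he : e + 2 * d = 2 * (π / 2))
    (he2 : 2 ≤ e) {x y : Q} (h : Agree f d x y) (heq : f x d = f y d) (heven : Even (f x d)) :
    FullStep x (rankLetter P π f True) e y :=
  fullStep_letterOf.2 ⟨hP _ (by omega) (by omega), .inr ⟨d, h, .inr ⟨he.le, .inr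
    ⟨trivial, heq.symm, heven⟩⟩⟩⟩

/-- Words over the letters of `f` lead from a pure state to everything that is not above it. -/
theorem walk_of_odd (hP : ∀ j, 1 ≤ j → j ≤ π → j ∈ P) {d e : ℕ} (he : e + 2 * d = 2 * (π / 2))
    (he2 : 2 ≤ e) {x y : Q} (h : Agree f d x y) (hle : f y d ≤ f x d) (hodd : Odd (f x d))
    {u : List (Letter Q P)} (hu : u ≠ []) (hl : ∀ a ∈ u, IsRankLetter P π f a) :
    Walk FullStep e x u y ∧ (f y d < f x d → HitWalk FullStep e x u y) := by
  obtain ⟨u, a, rfl⟩ := (List.eq_nil_or_concat' _).resolve_left hu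
  have hloop : Walk FullStep e x u x := Walk.loop fun b hb =>
    ⟨e - 1, by omega, fullStep_flat hP he he2 h.refl_of rfl hodd (hl b (by simp [hb]))⟩
  have ha := hl a (by simp)
  have hhit : f y d < f x d → HitWalk FullStep e x (u ++ [a]) y := fun hlt =>
    ⟨u, a, [], x, y, rfl, hloop, fullStep_down hP he he2 h hlt ha, .nil y⟩
  refine ⟨?_, hhit⟩
  rcases hle.lt_or_eq with hlt | heq
  · exact hloop.append (.cons (fullStep_down hP he he2 h hlt ha) le_rfl (.nil y))
  · exact hloop.append (.cons (fullStep_flat hP he he2 h heq.symm hodd ha) (by omega) (.nil y))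

/-- Words over the letters of `f` lead from a state to every lower state. -/
theorem hitWalk_of_lt (hf : IsRank π f) (hP : ∀ j, 1 ≤ j → j ≤ π → j ∈ P) {d e : ℕ}
    (he : e + 2 * d = 2 * (π / 2)) (he2 : 2 ≤ e) {x y : Q} (h : Agree f d x y)
    (hlt : f y d < f x d) {u : List (Letter Q P)} (hu : u ≠ [])
    (hl : ∀ a ∈ u, IsRankLetter P π f a) : HitWalk FullStep e x u y := by
  rcases Nat.even_or_odd (f x d) with heven | hodd
  · obtain ⟨k, hk⟩ := heven
    -- Strict letters forbid waiting in a recurrent class, so the walk drops at once to the pure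
    -- class just below and waits there.
    obtain ⟨z, hz, hzd⟩ := hf.tight x d (f x d - 1) ⟨k - 1, by omega⟩ (by omega)
    have hxz : Agree f d x z := fun i hi => ⟨(hz i hi).symm, (h i hi).2⟩
    obtain ⟨a, u, rfl⟩ := List.exists_cons_of_ne_nil hu
    have ha := hl a (by simp)
    by_cases hnil : u = []
    · subst hnil
      exact ⟨[], a, [], x, y, rfl, .nil x, fullStep_down hP he he2 h hlt ha, .nil y⟩
    · refine ⟨[], a, u, x, z, rfl, .nil x, fullStep_down hP he he2 hxz (by omega) ha, ?_⟩
      exact (walk_of_odd hP he he2 (hxz.symm.trans h) (by omega) (hzd ▸ ⟨k - 1, by omega⟩) hnil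
        fun b hb => hl b (by simp [hb])).1
  · exact (walk_of_odd hP he he2 h hlt.le hodd hu hl).2 hlt

/-- Words over the weak letter of `f` lead from a state to everything that is not above it. -/
theorem walk_of_le (hP : ∀ j, 1 ≤ j → j ≤ π → j ∈ P) {d e : ℕ} (he : e + 2 * d = 2 * (π / 2))
    (he2 : 2 ≤ e) {x y : Q} (h : Agree f d x y) (hle : f y d ≤ f x d)
    {u : List (Letter Q P)} (hu : u ≠ []) (hl : ∀ a ∈ u, a = rankLetter P π f True) :
    Walk FullStep e x u y := by
  rcases Nat.even_or_odd (f x d) with heven | hodd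
  · obtain ⟨u, a, rfl⟩ := (List.eq_nil_or_concat' _).resolve_left hu
    have ha := hl a (by simp)
    refine Walk.append (s' := x) (Walk.loop fun b hb => ⟨e, le_rfl, ?_⟩) (.cons ?_ le_rfl (.nil y))
    · rw [hl b (by simp [hb])]
      exact fullStep_stay hP he he2 h.refl_of rfl heven
    · rcases hle.lt_or_eq with hlt | heq
      · exact fullStep_down hP he he2 h hlt (.inl ha)
      · rw [ha]
        exact fullStep_stay hP he he2 h heq.symm heven
  · exact (walk_of_odd hP he he2 h hle hodd hu fun a ha => .inl (hl a ha)).1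

/-- Words over the weak letter of `f` lead from a recurrent state to itself. -/
theorem hitWalk_of_even (hP : ∀ j, 1 ≤ j → j ≤ π → j ∈ P) {d e : ℕ} (he : e + 2 * d = 2 * (π / 2))
    (he2 : 2 ≤ e) {x : Q} (h : Agree f d x x) (heven : Even (f x d))
    {u : List (Letter Q P)} (hu : u ≠ []) (hl : ∀ a ∈ u, a = rankLetter P π f True) :
    HitWalk FullStep e x u x := by
  have hstay := fullStep_stay hP he he2 h rfl heven
  obtain ⟨a, u, rfl⟩ := List.exists_cons_of_ne_nil hu
  refine ⟨[], a, u, x, x, rfl, .nil x, hl a (by simp) ▸ hstay, Walk.loop fun b hb => ?_⟩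
  exact ⟨e, le_rfl, hl b (by simp [hb]) ▸ hstay⟩

/-- Some state can be reached from itself with an even maximal priority by first reading a word
over the letters of `f` and then a word over the weak letter of `g`. -/
def MixedCycle (P : Finset ℕ) (π : ℕ) (f g : Q → ℕ → ℕ) : Prop :=
  ∃ q e, Even e ∧ ¬ Dead π f q ∧ ∀ u v : List (Letter Q P), u ≠ [] → v ≠ [] →
    (∀ a ∈ u, IsRankLetter P π f a) → (∀ a ∈ v, a = rankLetter P π g True) →
    HitWalk FullStep e q (u ++ v) q

/-- Words of `f` lead down from `x` to `y` and hit `e`; weak words of `g` lead back without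
exceeding `e`. -/
theorem mixedCycle_of_lt (hf : IsRank π f) (hP : ∀ j, 1 ≤ j → j ≤ π → j ∈ P)
    (hdead : ∀ q, Dead π f q ↔ Dead π g q) {d e : ℕ}
    (he : e + 2 * d = 2 * (π / 2)) (he2 : 2 ≤ e) {x y : Q} (h : Agree f d x y)
    (h' : Agree g d x y) (hlt : f y d < f x d) (hle : g x d ≤ g y d) : MixedCycle P π f g := by
  refine ⟨x, e, ?_, ?_, fun u v hu hv hlu hlv => ?_⟩
  · exact ⟨π / 2 - d, by omega⟩
  · intro hx
    rcases Nat.eq_zero_or_pos d with rfl | hpos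
    · obtain ⟨hπ, hev, hmax⟩ := (hdead x).1 hx
      have heq : g y 0 = g x 0 := le_antisymm (hmax y) hle
      have hy : Dead π f y := (hdead y).2 ⟨hπ, heq ▸ hev, fun z => heq ▸ hmax z⟩
      exact absurd (hy.2.2 x) (not_le.2 hlt)
    · exact Nat.not_even_iff_odd.2 (h 0 hpos).2 hx.2.1
  · exact (hitWalk_of_lt hf hP he he2 h hlt hu hlu).append
      (walk_of_le hP he he2 h'.symm hle hv hlv)

/-- The state waits with priority `e - 1` in its pure class of `f` and with priority `e` in its
recurrent class of `g`. -/
theorem mixedCycle_of_parity (hP : ∀ j, 1 ≤ j → j ≤ π → j ∈ P) {d e : ℕ}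
    (he : e + 2 * d = 2 * (π / 2)) (he2 : 2 ≤ e) {x : Q} (h : Agree f d x x)
    (h' : Agree g d x x) (hodd : Odd (f x d)) (heven : Even (g x d)) : MixedCycle P π f g := by
  refine ⟨x, e, ?_, ?_, fun u v hu hv hlu hlv => ?_⟩
  · exact ⟨π / 2 - d, by omega⟩
  · intro hx
    have : Odd (f x 0) := by
      rcases Nat.eq_zero_or_pos d with rfl | hpos
      · exact hodd
      · exact (h 0 hpos).2
    exact Nat.not_even_iff_odd.2 this hx.2.1
  · exact (walk_of_odd hP he he2 h le_rfl hodd hu hlu).1.append_hit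
      (hitWalk_of_even hP he he2 h' heven hv hlv)

/-- Without mixed cycles, `f` and `g` induce, depth by depth, the same strict order and the same
parities on each pure class. As no odd value is skipped, these data determine the values. -/
theorem mixedCycle_of_ne (hf : IsRank π f) (hg : IsRank π g)
    (hP : ∀ j, 1 ≤ j → j ≤ π → j ∈ P) (hdead : ∀ q, Dead π f q ↔ Dead π g q) (hne : f ≠ g) :
    MixedCycle P π f g ∨ MixedCycle P π g f := by
  by_contra hcon
  push Not at hcon
  obtain ⟨hfg, hgf⟩ := hcon
  refine hne (funext fun q => funext fun d => ?_)
  induction d using Nat.strong_induction_on generalizing q with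
  | _ d ih =>
    by_cases hodd : ∀ i < d, Odd (f q i)
    swap
    · push Not at hodd
      obtain ⟨i, hi, hev⟩ := hodd
      rw [Nat.not_odd_iff_even] at hev
      rw [hf.zero_of_even q i d hev hi, hg.zero_of_even q i d (ih i hi q ▸ hev) hi]
    rcases Nat.lt_or_ge d (π / 2) with hd | hd
    swap
    · rw [hf.zero_of_le q d hd, hg.zero_of_le q d hd]
    obtain ⟨e, he⟩ := Nat.exists_eq_add_of_le (show 2 * d ≤ 2 * (π / 2) by omega)
    rw [add_comm] at he
    have he2 : 2 ≤ e := by omega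
    have hag : ∀ x, (∀ i < d, f x i = f q i) → Agree f d q x ∧ Agree g d q x := fun x hx =>
      ⟨fun i hi => ⟨(hx i hi).symm, hodd i hi⟩, fun i hi => by
        rw [← ih i hi, ← ih i hi, hx i hi]
        exact ⟨rfl, hodd i hi⟩⟩
    have hlt : ∀ x y, (∀ i < d, f x i = f q i) → (∀ i < d, f y i = f q i) →
        (f y d < f x d ↔ g y d < g x d) := by
      intro x y hx hy
      have h1 := (hag x hx).1.symm.trans (hag y hy).1
      have h2 := (hag x hx).2.symm.trans (hag y hy).2
      constructor
      · intro hlt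
        by_contra hle
        exact hfg (mixedCycle_of_lt hf hP hdead he.symm he2 h1 h2 hlt (not_lt.1 hle))
      · intro hlt
        by_contra hle
        exact hgf (mixedCycle_of_lt hg hP (fun q => (hdead q).symm) he.symm he2 h2 h1 hlt
          (not_lt.1 hle))
    have hpar : ∀ x, (∀ i < d, f x i = f q i) → (Odd (f x d) ↔ Odd (g x d)) := by
      intro x hx
      have h1 := (hag x hx).1.symm.refl_of
      have h2 := (hag x hx).2.symm.refl_of
      constructor
      · intro ho
        by_contra hev
        exact hfg (mixedCycle_of_parity hP he.symm he2 h1 h2 ho (Nat.not_odd_iff_even.1 hev))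
      · intro ho
        by_contra hev
        exact hgf (mixedCycle_of_parity hP he.symm he2 h2 h1 ho (Nat.not_odd_iff_even.1 hev))
    have main : ∀ n x, (∀ i < d, f x i = f q i) → min (f x d) (g x d) = n → f x d = g x d := by
      intro n
      induction n using Nat.strong_induction_on with
      | _ n ihn =>
        intro x hx hmin
        have hp := hpar x hx
        simp only [Nat.odd_iff] at hp
        rcases lt_trichotomy (f x d) (g x d) with h | h | h
        -- The value is the least odd number that is at least `f x d`; equal parities put it below
        -- `g x d` or make it `f x d`. Then `f y d < f x d ≤ g y d` contradicts the induction
        -- hypothesis for `y`.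
        · obtain ⟨y, hy, hyd⟩ := hg.tight x d (2 * (f x d / 2) + 1) ⟨_, rfl⟩ (by omega)
          have hy' : ∀ i < d, f y i = f q i := fun i hi => by
            rw [ih i hi, hy i hi, ← ih i hi, hx i hi]
          have hlt' := (hlt x y hx hy').2 (by omega)
          have := ihn _ (by omega) y hy' rfl
          omega
        · exact h
        · obtain ⟨y, hy, hyd⟩ := hf.tight x d (2 * (g x d / 2) + 1) ⟨_, rfl⟩ (by omega)
          have hy' : ∀ i < d, f y i = f q i := fun i hi => by rw [hy i hi, hx i hi]
          have hlt' := (hlt x y hx hy').1 (by omega)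
          have := ihn _ (by omega) y hy' rfl
          omega
    exact main _ q (fun _ _ => rfl) rfl

/-- All states that are not dead can be reached. -/
theorem exists_walk_of_not_dead (hf : IsRank π f) (hP : ∀ j, 1 ≤ j → j ≤ π → j ∈ P) (hπ : 2 ≤ π)
    {x : Q} (hx : ¬ Dead π f x) {u : List (Letter Q P)} (hl : ∀ a ∈ u, IsRankLetter P π f a) :
    ∃ q, Walk FullStep π q (killLetter P π f :: u) x := by
  have hkill : ∀ y, ¬ Dead π f y → FullStep y (killLetter P π f) 1 y := fun y hy =>
    fullStep_letterOf.2 ⟨hP 1 le_rfl (by omega), hy, rfl, rfl⟩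
  have h0 : ∀ y z, Agree f 0 y z := fun y z i hi => absurd hi (Nat.not_lt_zero i)
  rcases Nat.even_or_odd π with hev | hodd
  · have h2 : 2 * (π / 2) = π := Nat.two_mul_div_two_of_even hev
    obtain ⟨y, hyodd, hle⟩ : ∃ y, Odd (f y 0) ∧ f x 0 ≤ f y 0 := by
      rcases Nat.even_or_odd (f x 0) with hxe | hxo
      · obtain ⟨z, hz⟩ : ∃ z, f x 0 < f z 0 := by
          by_contra hcon
          push Not at hcon
          exact hx ⟨hev, hxe, hcon⟩
        obtain ⟨y, -, hy⟩ := hf.tight z 0 (f x 0 + 1) hxe.add_one hz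
        exact ⟨y, hy ▸ hxe.add_one, by omega⟩
      · exact ⟨x, hxo, le_rfl⟩
    by_cases hnil : u = []
    · subst hnil
      exact ⟨x, .cons (hkill x hx) (by omega) (.nil x)⟩
    · refine ⟨y, .cons (hkill y fun h => Nat.not_even_iff_odd.2 hyodd h.2.1) (by omega) ?_⟩
      exact (walk_of_odd hP (d := 0) (by omega) hπ (h0 y x) hle hyodd hnil hl).1
  · refine ⟨x, .cons (hkill x hx) (by omega) (Walk.loop fun a ha => ⟨π, le_rfl, ?_⟩)⟩
    obtain ⟨k, hk⟩ := hodd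
    rcases hl a ha with rfl | rfl <;>
    exact fullStep_letterOf.2 ⟨hP _ (by omega) le_rfl, .inr ⟨0, h0 x x, .inl (by omega)⟩⟩

theorem hitWalk_of_dead (hP : ∀ j, 1 ≤ j → j ≤ π → j ∈ P) (hπ : 2 ≤ π) {x : Q}
    (hx : Dead π f x) {u : List (Letter Q P)} (hu : u ≠ [])
    (hl : ∀ a ∈ u, IsRankLetter P π f a) : HitWalk FullStep π x u x := by
  have hstep : ∀ a, IsRankLetter P π f a → FullStep x a π x := by
    rintro a (rfl | rfl) <;>
    exact fullStep_letterOf.2 ⟨hP _ (by omega) le_rfl, .inl hx⟩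
  obtain ⟨a, u, rfl⟩ := List.exists_cons_of_ne_nil hu
  exact ⟨[], a, u, x, x, rfl, .nil x, hstep a (hl a (by simp)), Walk.loop fun b hb =>
    ⟨π, le_rfl, hstep b (hl b (by simp [hb]))⟩⟩

end Ranks

/-! ### The rank function of a flattened nested history tree -/

namespace FNHT

variable {Q : Type*} {π : ℕ} {t : FNHT Q π}

open Classical in
/-- The position of `q` below the stepchild `v`. -/
noncomputable def posAt (t : FNHT Q π) (v : List Dir) (q : Q) : ℕ :=
  if h : ∃ c, q ∈ t.lp (v ++ [Dir.nat c]) then 2 * h.choose + 1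
  else if h : ∃ c, q ∈ t.lr (v ++ [Dir.nat c]) then 2 * h.choose + 2 else 0

/-- The address of the stepchild at depth `d` that may contain `q`. -/
noncomputable def addr (t : FNHT Q π) (q : Q) : ℕ → List Dir
  | 0 => []
  | d + 1 => addr t q d ++ [Dir.nat (t.posAt (addr t q d) q / 2)] ++ [Dir.step]

/-- The rank function of a history tree. -/
noncomputable def rank (t : FNHT Q π) (q : Q) (d : ℕ) : ℕ := t.posAt (t.addr q d) q

theorem nil_mem (t : FNHT Q π) : [] ∈ t.tree := by
  obtain ⟨v, hv⟩ := t.nonempty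
  induction v using List.reverseRecOn with
  | nil => exact hv
  | append_singleton v x ih => exact ih (t.prefix_closed v x hv)

theorem isStepchild_or_isNaturalChild (v : List Dir) : IsStepchild v ∨ IsNaturalChild v := by
  induction v using List.reverseRecOn with
  | nil => exact .inl (.inl rfl)
  | append_singleton v x _ =>
    cases x with
    | step => exact .inl (.inr ⟨v, rfl⟩)
    | nat c => exact .inr ⟨v, c, rfl⟩

theorem isNaturalChild_append (v : List Dir) (c : ℕ) : IsNaturalChild (v ++ [Dir.nat c]) :=
  ⟨v, c, rfl⟩

theorem isStepchild_append (v : List Dir) : IsStepchild (v ++ [Dir.step]) := .inr ⟨v, rfl⟩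

theorem isStepchild_of_nat_mem {v : List Dir} {c : ℕ} (h : v ++ [Dir.nat c] ∈ t.tree) :
    IsStepchild v :=
  (isStepchild_or_isNaturalChild v).resolve_right fun hv => t.natural_children v c hv h

theorem isNaturalChild_of_step_mem {v : List Dir} (h : v ++ [Dir.step] ∈ t.tree) :
    IsNaturalChild v :=
  (isStepchild_or_isNaturalChild v).resolve_left fun hv => t.stepchild_children v hv h

theorem mem_tree_of_lp {v : List Dir} {q : Q} (h : q ∈ t.lp v) : v ∈ t.tree := by
  by_contra hv
  simp [t.lp_default v hv] at h

theorem mem_tree_of_lr {v : List Dir} {q : Q} (h : q ∈ t.lr v) : v ∈ t.tree := by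
  by_contra hv
  simp [t.lr_default v hv] at h

theorem mem_tree_of_ls {v : List Dir} {q : Q} (h : q ∈ t.ls v) : v ∈ t.tree := by
  by_contra hv
  simp [t.ls_default v hv] at h

theorem mem_ls_nat {v : List Dir} {c : ℕ} {q : Q} :
    q ∈ t.ls (v ++ [Dir.nat c]) ↔ q ∈ t.lp (v ++ [Dir.nat c]) ∨ q ∈ t.lr (v ++ [Dir.nat c]) := by
  by_cases h : v ++ [Dir.nat c] ∈ t.tree
  · rw [t.natural_ls _ h (isNaturalChild_append v c), Set.mem_union]
  · simp [t.ls_default _ h, t.lp_default _ h, t.lr_default _ h]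

theorem nat_unique {v : List Dir} {c c' : ℕ} {q : Q} (h : q ∈ t.ls (v ++ [Dir.nat c]))
    (h' : q ∈ t.ls (v ++ [Dir.nat c'])) : c = c' := by
  by_contra hne
  have hc := mem_tree_of_ls h
  exact Set.disjoint_left.1 (t.stepchild_disjoint v (t.prefix_closed _ _ hc)
    (isStepchild_of_nat_mem hc) c c' hne hc (mem_tree_of_ls h')) h h'

theorem mem_ls_of_nat {v : List Dir} {c : ℕ} {q : Q} (h : q ∈ t.ls (v ++ [Dir.nat c])) :
    q ∈ t.ls v := by
  have hc := mem_tree_of_ls h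
  rw [t.stepchild_ls v (t.prefix_closed _ _ hc) (isStepchild_of_nat_mem hc)]
  exact .inr (Set.mem_biUnion (show c ∈ {c : ℕ | v ++ [Dir.nat c] ∈ t.tree} from hc) h)

theorem posAt_of_lp {v : List Dir} {c : ℕ} {q : Q} (h : q ∈ t.lp (v ++ [Dir.nat c])) :
    t.posAt v q = 2 * c + 1 := by
  have hex : ∃ c, q ∈ t.lp (v ++ [Dir.nat c]) := ⟨c, h⟩
  rw [posAt, dif_pos hex,
    nat_unique (mem_ls_nat.2 (.inl hex.choose_spec)) (mem_ls_nat.2 (.inl h))]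

theorem posAt_of_lr {v : List Dir} {c : ℕ} {q : Q} (h : q ∈ t.lr (v ++ [Dir.nat c])) :
    t.posAt v q = 2 * c + 2 := by
  have hex : ∃ c, q ∈ t.lr (v ++ [Dir.nat c]) := ⟨c, h⟩
  have hnot : ¬ ∃ c, q ∈ t.lp (v ++ [Dir.nat c]) := by
    rintro ⟨c', h'⟩
    obtain rfl := nat_unique (mem_ls_nat.2 (.inl h')) (mem_ls_nat.2 (.inr h))
    exact Set.disjoint_left.1 (t.natural_disjoint _ (mem_tree_of_lr h)
      (isNaturalChild_append v c')) h' h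
  rw [posAt, dif_neg hnot, dif_pos hex,
    nat_unique (mem_ls_nat.2 (.inr hex.choose_spec)) (mem_ls_nat.2 (.inr h))]

theorem posAt_cases (t : FNHT Q π) (v : List Dir) (q : Q) :
    (∃ c, q ∈ t.lp (v ++ [Dir.nat c]) ∧ t.posAt v q = 2 * c + 1) ∨
      (∃ c, q ∈ t.lr (v ++ [Dir.nat c]) ∧ t.posAt v q = 2 * c + 2) ∨
      ((∀ c, q ∉ t.ls (v ++ [Dir.nat c])) ∧ t.posAt v q = 0) := by
  by_cases h : ∃ c, q ∈ t.lp (v ++ [Dir.nat c])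
  · obtain ⟨c, h⟩ := h
    exact .inl ⟨c, h, posAt_of_lp h⟩
  by_cases h' : ∃ c, q ∈ t.lr (v ++ [Dir.nat c])
  · obtain ⟨c, h'⟩ := h'
    exact .inr (.inl ⟨c, h', posAt_of_lr h'⟩)
  · refine .inr (.inr ⟨fun c hc => ?_, by rw [posAt, dif_neg h, dif_neg h']⟩)
    rcases mem_ls_nat.1 hc with hc | hc
    · exact h ⟨c, hc⟩
    · exact h' ⟨c, hc⟩

theorem mem_lp_iff_posAt {v : List Dir} {c : ℕ} {q : Q} :
    q ∈ t.lp (v ++ [Dir.nat c]) ↔ t.posAt v q = 2 * c + 1 := by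
  refine ⟨posAt_of_lp, fun h => ?_⟩
  rcases t.posAt_cases v q with ⟨c', hc, hp⟩ | ⟨c', hc, hp⟩ | ⟨-, hp⟩
  · obtain rfl : c = c' := by omega
    exact hc
  · omega
  · omega

theorem mem_lr_iff_posAt {v : List Dir} {c : ℕ} {q : Q} :
    q ∈ t.lr (v ++ [Dir.nat c]) ↔ t.posAt v q = 2 * c + 2 := by
  refine ⟨posAt_of_lr, fun h => ?_⟩
  rcases t.posAt_cases v q with ⟨c', hc, hp⟩ | ⟨c', hc, hp⟩ | ⟨-, hp⟩
  · omega
  · obtain rfl : c = c' := by omega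
    exact hc
  · omega

theorem exists_nat_of_posAt_ne_zero {v : List Dir} {q : Q} (h : t.posAt v q ≠ 0) :
    ∃ c, q ∈ t.ls (v ++ [Dir.nat c]) ∧ t.posAt v q ≤ 2 * c + 2 := by
  rcases t.posAt_cases v q with ⟨c, hc, hp⟩ | ⟨c, hc, hp⟩ | ⟨-, hp⟩
  · exact ⟨c, mem_ls_nat.2 (.inl hc), by omega⟩
  · exact ⟨c, mem_ls_nat.2 (.inr hc), by omega⟩
  · exact absurd hp h

theorem mem_ls_of_posAt_ne_zero {v : List Dir} {q : Q} (h : t.posAt v q ≠ 0) : q ∈ t.ls v := by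
  obtain ⟨c, hc, -⟩ := exists_nat_of_posAt_ne_zero h
  exact mem_ls_of_nat hc

/-- This makes `addr` harmless below a recurrent position: the address continues, but no stepchild
there contains `q`, so the later positions are `0`. -/
theorem odd_posAt_of_succ {v : List Dir} {c : ℕ} {q : Q}
    (h : t.posAt (v ++ [Dir.nat c] ++ [Dir.step]) q ≠ 0) : t.posAt v q = 2 * c + 1 := by
  have hq := mem_ls_of_posAt_ne_zero h
  rw [t.natural_step _ (isNaturalChild_append v c) (mem_tree_of_ls hq)] at hq
  exact posAt_of_lp hq

theorem length_addr (t : FNHT Q π) (q : Q) (d : ℕ) : (t.addr q d).length = 2 * d := by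
  induction d with
  | zero => rfl
  | succ d ih => simp [addr, ih]; omega

theorem odd_rank_of_succ {q : Q} {d : ℕ} (h : t.rank q (d + 1) ≠ 0) : Odd (t.rank q d) :=
  ⟨_, odd_posAt_of_succ h⟩

theorem odd_rank_of_lt {q : Q} {i d : ℕ} (hi : i < d) (h : t.rank q d ≠ 0) :
    Odd (t.rank q i) := by
  induction d with
  | zero => omega
  | succ d ih =>
    have hd := odd_rank_of_succ h
    rcases Nat.lt_succ_iff_lt_or_eq.1 hi with hlt | rfl
    · refine ih hlt fun h0 => ?_
      rw [h0] at hd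
      exact absurd hd (by decide)
    · exact hd

theorem ll_addr {q : Q} {d : ℕ} (h : t.addr q d ∈ t.tree) :
    t.ll (t.addr q d) + 2 * d = maxEven π := by
  induction d with
  | zero => exact t.ll_root
  | succ d ih =>
    have h1 := t.prefix_closed _ _ h
    have h2 := t.prefix_closed _ _ h1
    have h3 := t.ll_step _ h
    have h4 := t.ll_nat _ _ h1
    have := ih h2
    rw [addr]
    omega

theorem addr_eq_of_le {q x : Q} {i d : ℕ} (hi : i ≤ d) (h : t.addr q d = t.addr x d) :
    t.addr q i = t.addr x i := by
  induction d with
  | zero =>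
    obtain rfl : i = 0 := by omega
    exact h
  | succ d ih =>
    rcases Nat.le_succ_iff.1 hi with hle | rfl
    · refine ih hle ?_
      simp only [addr, List.append_assoc] at h
      exact (List.append_inj h (by rw [length_addr, length_addr])).1
    · exact h

theorem addr_of_mem_lp {v : List Dir} {q : Q} {c : ℕ} (h : q ∈ t.lp (v ++ [Dir.nat c])) :
    t.addr q (v.length / 2 + 1) = v ++ [Dir.nat c] ++ [Dir.step] := by
  induction hn : v.length using Nat.strong_induction_on generalizing v c with
  | _ n ih =>
    subst hn
    have hpos := posAt_of_lp h
    have hv : t.addr q (v.length / 2) = v := by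
      have hmem := mem_tree_of_lp h
      have hqv := mem_ls_of_nat (mem_ls_nat.2 (.inl h))
      rcases isStepchild_of_nat_mem hmem with rfl | ⟨w, rfl⟩
      · rfl
      · have hw := isNaturalChild_of_step_mem (t.prefix_closed _ _ hmem)
        rw [t.natural_step w hw (mem_tree_of_ls hqv)] at hqv
        obtain ⟨u, c', rfl⟩ := hw
        rw [show (u ++ [Dir.nat c'] ++ [Dir.step]).length / 2 = u.length / 2 + 1 by simp]
        exact ih u.length (by simp) hqv rfl
    rw [addr, hv, hpos]
    congr 4
    omega

theorem addr_of_mem_ls {v : List Dir} {q : Q} (hv : IsStepchild v) (h : q ∈ t.ls v) :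
    t.addr q (v.length / 2) = v := by
  rcases hv with rfl | ⟨w, rfl⟩
  · rfl
  · have hw := isNaturalChild_of_step_mem (mem_tree_of_ls h)
    rw [t.natural_step w hw (mem_tree_of_ls h)] at h
    obtain ⟨u, c', rfl⟩ := hw
    rw [show (u ++ [Dir.nat c'] ++ [Dir.step]).length / 2 = u.length / 2 + 1 by simp]
    exact addr_of_mem_lp h

theorem rank_of_mem_ls {v : List Dir} {q : Q} (hv : IsStepchild v) (h : q ∈ t.ls v) :
    t.rank q (v.length / 2) = t.posAt v q := by
  rw [rank, addr_of_mem_ls hv h]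

/-- The depth is bounded because levels drop by two and stay at least two. Tightness combines the
closure under smaller siblings with the non-emptiness of pure labels. -/
theorem isRank_rank (t : FNHT Q π) : IsRank π t.rank where
  zero_of_even q i j hi hij := by
    by_contra h
    exact Nat.not_even_iff_odd.2 (odd_rank_of_lt hij h) hi
  zero_of_le q d hd := by
    by_contra h
    have hmem := mem_tree_of_ls (mem_ls_of_posAt_ne_zero h)
    have h1 := t.two_le_ll _ hmem
    have h2 := ll_addr hmem
    unfold maxEven at h2
    omega
  tight q d c hc hle := by
    obtain ⟨k, rfl⟩ := hc
    have hq : t.rank q d ≠ 0 := by omega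
    obtain ⟨c', hc', hle'⟩ := exists_nat_of_posAt_ne_zero (t := t) (v := t.addr q d) hq
    have hmem' := mem_tree_of_ls hc'
    have hmem : t.addr q d ++ [Dir.nat k] ∈ t.tree := by
      have : t.rank q d ≤ 2 * c' + 2 := hle'
      rcases (show k ≤ c' by omega).lt_or_eq with hlt | rfl
      · exact t.order_closed _ _ _ hlt hmem'
      · exact hmem'
    obtain ⟨x, hx⟩ := t.natural_lp_nonempty _ hmem (isNaturalChild_append _ _)
    have haddr := addr_of_mem_ls (isStepchild_of_nat_mem hmem)
      (mem_ls_of_nat (mem_ls_nat.2 (.inl hx)))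
    rw [length_addr, Nat.mul_div_cancel_left _ two_pos] at haddr
    have hxd : t.rank x d = 2 * k + 1 := by rw [rank, haddr, posAt_of_lp hx]
    refine ⟨x, fun i hi => ?_, hxd⟩
    obtain ⟨a, ha⟩ := odd_rank_of_lt (t := t) (q := q) hi hq
    obtain ⟨b, hb⟩ := odd_rank_of_lt (t := t) (q := x) hi (by omega)
    -- The common address fixes the halves of the two earlier positions, and both positions are odd.
    have h1 := addr_eq_of_le (show i + 1 ≤ d by omega) haddr
    simp only [addr, List.append_assoc] at h1
    have h2 := (List.append_inj h1 (by rw [length_addr, length_addr])).2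
    simp only [List.cons_append, List.cons.injEq, Dir.nat.injEq] at h2
    have h3 : t.rank x i / 2 = t.rank q i / 2 := h2.1
    omega

/-! #### The rank function determines the tree -/

/-- Only the root can be a stepchild without children, so every other stepchild is visible in the
rank function through a pure state of one of its children. -/
theorem exists_mem_lp_of_step_mem {v : List Dir} (h : v ++ [Dir.step] ∈ t.tree) :
    ∃ q ∈ t.lp v, t.posAt (v ++ [Dir.step]) q ≠ 0 := by
  have hstep := isStepchild_append v
  obtain ⟨c, hc⟩ : ∃ c, v ++ [Dir.step] ++ [Dir.nat c] ∈ t.tree := by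
    by_contra hcon
    push Not at hcon
    rcases t.leaf _ h (fun x => by
      cases x with
      | step => exact t.stepchild_children _ hstep
      | nat c => exact hcon c) with ⟨u, c, hu⟩ | ⟨hu, -⟩
    · have := (List.append_inj' hu rfl).2
      simp at this
    · simp at hu
  obtain ⟨q, hq⟩ := t.natural_lp_nonempty _ hc (isNaturalChild_append _ _)
  refine ⟨q, ?_, by rw [posAt_of_lp hq]; omega⟩
  rw [← t.natural_step v (isNaturalChild_of_step_mem h) h]
  exact mem_ls_of_nat (mem_ls_nat.2 (.inl hq))

variable {t' : FNHT Q π}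

theorem step_mem_of_rank_eq (hr : t.rank = t'.rank) {v : List Dir}
    (hlp : t.lp v = t'.lp v) (h : v ++ [Dir.step] ∈ t.tree) : v ++ [Dir.step] ∈ t'.tree := by
  obtain ⟨q, hq, hpos⟩ := exists_mem_lp_of_step_mem h
  obtain ⟨u, c, rfl⟩ := isNaturalChild_of_step_mem h
  have h1 : t.rank q (u.length / 2 + 1) ≠ 0 := by
    rw [rank, addr_of_mem_lp hq]
    exact hpos
  rw [hr, rank, addr_of_mem_lp (hlp ▸ hq)] at h1
  exact mem_tree_of_ls (mem_ls_of_posAt_ne_zero h1)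

theorem posAt_eq_of_rank_eq (hr : t.rank = t'.rank) {v : List Dir} (hv : IsStepchild v)
    (hls : t.ls v = t'.ls v) (q : Q) : t.posAt v q = t'.posAt v q := by
  by_cases hq : q ∈ t.ls v
  · rw [← rank_of_mem_ls hv hq, ← rank_of_mem_ls hv (hls ▸ hq), hr]
  · rw [not_imp_comm.1 mem_ls_of_posAt_ne_zero hq, not_imp_comm.1 mem_ls_of_posAt_ne_zero (hls ▸ hq)]

theorem nat_mem_iff {v : List Dir} {c : ℕ} :
    v ++ [Dir.nat c] ∈ t.tree ↔ (t.lp (v ++ [Dir.nat c])).Nonempty :=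
  ⟨fun h => t.natural_lp_nonempty _ h (isNaturalChild_append v c), fun ⟨_, h⟩ => mem_tree_of_lp h⟩

theorem labels_eq_of_rank_eq (ht : t.IsFull) (ht' : t'.IsFull) (hr : t.rank = t'.rank)
    (v : List Dir) : (v ∈ t.tree ↔ v ∈ t'.tree) ∧ t.ls v = t'.ls v ∧ t.lp v = t'.lp v ∧
      (IsNaturalChild v → t.lr v = t'.lr v) ∧ t.ll v = t'.ll v := by
  induction v using List.reverseRecOn with
  | nil =>
    refine ⟨iff_of_true t.nil_mem t'.nil_mem, ht.trans ht'.symm, ?_, ?_, ?_⟩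
    · rw [t.stepchild_lp _ t.nil_mem (.inl rfl), t'.stepchild_lp _ t'.nil_mem (.inl rfl)]
    · rintro ⟨u, c, h⟩
      simp at h
    · rw [t.ll_root, t'.ll_root]
  | append_singleton v x ih =>
    obtain ⟨hmem, hls, hlp, -, hll⟩ := ih
    have outside : v ++ [x] ∉ t.tree → v ++ [x] ∉ t'.tree →
        (v ++ [x] ∈ t.tree ↔ v ++ [x] ∈ t'.tree) ∧ t.ls (v ++ [x]) = t'.ls (v ++ [x]) ∧
        t.lp (v ++ [x]) = t'.lp (v ++ [x]) ∧
        (IsNaturalChild (v ++ [x]) → t.lr (v ++ [x]) = t'.lr (v ++ [x])) ∧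
        t.ll (v ++ [x]) = t'.ll (v ++ [x]) := by
      intro h h'
      refine ⟨iff_of_false h h', ?_, ?_, fun _ => ?_, ?_⟩
      · rw [t.ls_default _ h, t'.ls_default _ h']
      · rw [t.lp_default _ h, t'.lp_default _ h']
      · rw [t.lr_default _ h, t'.lr_default _ h']
      · rw [t.ll_default _ h, t'.ll_default _ h']
    cases x with
    | step =>
      have hiff : v ++ [Dir.step] ∈ t.tree ↔ v ++ [Dir.step] ∈ t'.tree :=
        ⟨step_mem_of_rank_eq hr hlp, step_mem_of_rank_eq hr.symm hlp.symm⟩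
      by_cases h : v ++ [Dir.step] ∈ t.tree
      · have h' := hiff.1 h
        have hv := isNaturalChild_of_step_mem h
        refine ⟨hiff, ?_, ?_, ?_, ?_⟩
        · rw [t.natural_step v hv h, t'.natural_step v hv h', hlp]
        · rw [t.stepchild_lp _ h (isStepchild_append v), t'.stepchild_lp _ h' (isStepchild_append v)]
        · rintro ⟨u, c, hu⟩
          have := (List.append_inj' hu rfl).2
          simp at this
        · have h1 := t.ll_step v h
          have h2 := t'.ll_step v h'
          omega
      · exact outside h (fun h' => h (hiff.2 h'))
    | nat c =>
      rcases isStepchild_or_isNaturalChild v with hv | hv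
      swap
      · exact outside (t.natural_children v c hv) (t'.natural_children v c hv)
      have hpos := posAt_eq_of_rank_eq hr hv hls
      have hlp' : t.lp (v ++ [Dir.nat c]) = t'.lp (v ++ [Dir.nat c]) := by
        ext q
        rw [mem_lp_iff_posAt, mem_lp_iff_posAt, hpos]
      have hlr' : t.lr (v ++ [Dir.nat c]) = t'.lr (v ++ [Dir.nat c]) := by
        ext q
        rw [mem_lr_iff_posAt, mem_lr_iff_posAt, hpos]
      have hiff : v ++ [Dir.nat c] ∈ t.tree ↔ v ++ [Dir.nat c] ∈ t'.tree := by
        rw [nat_mem_iff, nat_mem_iff, hlp']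
      by_cases h : v ++ [Dir.nat c] ∈ t.tree
      · refine ⟨hiff, ?_, hlp', fun _ => hlr', ?_⟩
        · ext q
          rw [mem_ls_nat, mem_ls_nat, hlp', hlr']
        · rw [t.ll_nat v c h, t'.ll_nat v c (hiff.1 h), hll]
      · exact outside h (fun h' => h (hiff.2 h'))

theorem lr_eq_diff {v : List Dir} (h : v ∈ t.tree) (hv : IsStepchild v) :
    t.lr v = t.ls v \ ⋃ c, t.ls (v ++ [Dir.nat c]) := by
  have hU : (⋃ c ∈ {c : ℕ | v ++ [Dir.nat c] ∈ t.tree}, t.ls (v ++ [Dir.nat c])) =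
      ⋃ c, t.ls (v ++ [Dir.nat c]) := by
    ext q
    simp only [Set.mem_iUnion, Set.mem_ofPred_eq, exists_prop]
    exact exists_congr fun c => ⟨And.right, fun hq => ⟨mem_tree_of_ls hq, hq⟩⟩
  rw [t.stepchild_ls v h hv, hU, Set.union_sdiff_right]
  exact (hU ▸ t.stepchild_lr_disjoint v h hv).sdiff_eq_left.symm

theorem eq_of_rank_eq (ht : t.IsFull) (ht' : t'.IsFull) (hr : t.rank = t'.rank) : t = t' := by
  have h := labels_eq_of_rank_eq ht ht' hr
  have hls : t.ls = t'.ls := funext fun v => (h v).2.1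
  refine FNHT.ext (Finset.ext fun v => (h v).1) hls (funext fun v => (h v).2.2.2.2)
    (funext fun v => (h v).2.2.1) (funext fun v => ?_)
  rcases isStepchild_or_isNaturalChild v with hv | hv
  · by_cases hmem : v ∈ t.tree
    · rw [lr_eq_diff hmem hv, lr_eq_diff ((h v).1.1 hmem) hv, hls]
    · rw [t.lr_default v hmem, t'.lr_default v fun h' => hmem ((h v).1.2 h')]
  · exact (h v).2.2.2.1 hv

end FNHT

/-! ### Loops of Büchi automata -/

/-- The letter `κ`, followed by `δ ^ N σ` forever. -/
noncomputable def blockWord {A : Type*} (κ δ σ : A) (N i : ℕ) : A :=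
  if i = 0 then κ else if N + 1 ∣ i then σ else δ

theorem blockWord_mem {A : Type*} {κ δ σ : A} {N i : ℕ} (hi : 1 ≤ i) :
    blockWord κ δ σ N i = δ ∨ blockWord κ δ σ N i = σ := by
  unfold blockWord
  rw [if_neg (by omega)]
  split_ifs
  · exact .inr rfl
  · exact .inl rfl

theorem blockWord_frequently {A : Type*} {κ δ σ : A} {N : ℕ} :
    ∃ᶠ i in Filter.atTop, blockWord κ δ σ N i = σ := by
  rw [Filter.frequently_atTop]
  intro m
  refine ⟨(N + 1) * (m + 1), by nlinarith, ?_⟩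
  rw [blockWord, if_neg (by positivity), if_pos (Dvd.intro _ rfl)]

section Loops

variable {S A : Type*} {B : BuchiAutomaton S A}

theorem BuchiAutomaton.IsRun.walk {α : ℕ → A} {ρ : ℕ → S} (h : B.IsRun α ρ) (i n : ℕ) :
    Walk B.Step 1 (ρ i) ((List.range' i n).map α) (ρ (i + n)) := by
  induction n generalizing i with
  | zero => exact .nil _
  | succ n ih =>
    rw [List.range'_succ, List.map_cons]
    refine .cons (s' := ρ (i + 1)) (j := 0) ⟨h.2 i, by simp⟩ (by omega) ?_
    have := ih (i + 1)
    rwa [show i + 1 + n = i + (n + 1) by omega] at this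

theorem BuchiAutomaton.IsRun.hitWalk {α : ℕ → A} {ρ : ℕ → S} (h : B.IsRun α ρ) {i k j : ℕ}
    (hik : i ≤ k) (hkj : k < j) (hk : (ρ k, α k, ρ (k + 1)) ∈ B.final) :
    HitWalk B.Step 1 (ρ i) ((List.range' i (j - i)).map α) (ρ j) := by
  obtain ⟨a, rfl⟩ := Nat.exists_eq_add_of_le hik
  obtain ⟨b, rfl⟩ := Nat.exists_eq_add_of_le (show i + a + 1 ≤ j by omega)
  refine ⟨(List.range' i a).map α, α (i + a), (List.range' (i + a + 1) b).map α, ρ (i + a),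
    ρ (i + a + 1), ?_, h.walk i a, ⟨h.2 _, fun _ => hk⟩, h.walk _ b⟩
  rw [show i + a + 1 + b - i = a + (b + 1) by omega, ← List.range'_append_1, List.map_append,
    List.range'_succ, List.map_cons]

/-- `s` is reached after the letter `κ` and lies on a loop over `δ` and on an accepting loop over
`δ` and `σ`. -/
def Recurs (B : BuchiAutomaton S A) (κ δ σ : A) (s : S) : Prop :=
  ∃ s₀ pre u v, s₀ ∈ B.init ∧ Walk B.Step 1 s₀ (κ :: pre) s ∧ (∀ a ∈ pre, a = δ ∨ a = σ) ∧
    (∀ a ∈ u, a = δ ∨ a = σ) ∧ HitWalk B.Step 1 s u s ∧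
    v ≠ [] ∧ (∀ a ∈ v, a = δ) ∧ Walk B.Step 1 s v s

theorem exists_recurs [Fintype S] {κ δ σ : A}
    (h : blockWord κ δ σ (Fintype.card S) ∈ B.language) : ∃ s, Recurs B κ δ σ s := by
  obtain ⟨ρ, hrun, hacc⟩ := h
  set N := Fintype.card S with hN
  set α := blockWord κ δ σ N with hα
  -- The `N` letters `δ` of a block are surrounded by `N + 1` states, so one state repeats with only
  -- `δ` read in between.
  have block : ∀ m, ∃ a b, m * (N + 1) < a ∧ a < b ∧ b ≤ (m + 1) * (N + 1) ∧ ρ a = ρ b := by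
    intro m
    obtain ⟨x, y, hxy, hρ⟩ := Fintype.exists_ne_map_eq_of_card_lt
      (fun x : Fin (N + 1) => ρ (m * (N + 1) + 1 + x)) (by simp [hN])
    have hx := x.2
    have hy := y.2
    have hxy' : (x : ℕ) ≠ y := fun h => hxy (Fin.ext h)
    have hm : (m + 1) * (N + 1) = m * (N + 1) + (N + 1) := by ring
    rcases lt_or_gt_of_ne hxy' with hlt | hlt
    · exact ⟨_, _, by omega, by omega, by omega, hρ⟩
    · exact ⟨_, _, by omega, by omega, by omega, hρ.symm⟩
  choose a b hma hab hbm hρ using block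
  -- One state repeats in infinitely many blocks; two such blocks with an accepting transition
  -- between them give the accepting loop.
  obtain ⟨s, hs⟩ := Finite.exists_infinite_fiber fun m => ρ (a m)
  rw [Set.infinite_coe_iff] at hs
  obtain ⟨m, hm⟩ := hs.nonempty
  obtain ⟨k, hk, hfin⟩ := Filter.frequently_atTop.1 hacc (a m)
  obtain ⟨m', hm', hlt⟩ := hs.exists_gt k
  have hm : ρ (a m) = s := hm
  have hm' : ρ (a m') = s := hm'
  have hkm' : k < a m' := by
    have := hma m'
    nlinarith
  have hletters : ∀ i n, 1 ≤ i → ∀ x ∈ (List.range' i n).map α, x = δ ∨ x = σ := by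
    intro i n hi x hx
    obtain ⟨j, hj, rfl⟩ := List.mem_map.1 hx
    rw [List.mem_range'_1] at hj
    exact blockWord_mem (by omega)
  have ha1 : 1 ≤ a m := by
    have := hma m
    omega
  refine ⟨s, ρ 0, (List.range' 1 (a m - 1)).map α, (List.range' (a m) (a m' - a m)).map α,
    (List.range' (a m) (b m - a m)).map α, hrun.1, ?_, hletters _ _ le_rfl, hletters _ _ ha1,
    ?_, ?_, ?_, ?_⟩
  · have := hrun.walk 0 (a m)
    obtain ⟨n, hn⟩ := Nat.exists_eq_add_of_le' ha1
    rw [zero_add, hm, hn, List.range'_succ, List.map_cons] at this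
    rw [hn]
    simpa [hα, blockWord] using this
  · have := hrun.hitWalk hk hkm' hfin
    rwa [hm, hm'] at this
  · have := hab m
    simp [List.range'_eq_nil_iff]
    omega
  · intro x hx
    obtain ⟨j, hj, rfl⟩ := List.mem_map.1 hx
    rw [List.mem_range'_1] at hj
    have h1 := hma m
    have h2 := hbm m
    have h3 := hab m
    rw [hα, blockWord, if_neg (by omega), if_neg]
    rintro ⟨c, hc⟩
    have h4 : m * (N + 1) < c * (N + 1) := by nlinarith
    have h5 : c * (N + 1) < (m + 1) * (N + 1) := by
      have : j < b m := by omega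
      nlinarith
    have h6 := Nat.lt_of_mul_lt_mul_right h4
    have h7 := Nat.lt_of_mul_lt_mul_right h5
    omega
  · have := hrun.walk (a m) (b m - a m)
    rwa [Nat.add_sub_cancel' (hab m).le, ← hρ m, hm] at this

end Loops

/-! ### The lower bound -/

/-- `s` recurs on the words of the rank function `f`. -/
def RankState {Q S : Type*} {P : Finset ℕ} (B : BuchiAutomaton S (Letter Q P)) (π : ℕ)
    (f : Q → ℕ → ℕ) (s : S) : Prop :=
  Recurs B (killLetter P π f) (rankLetter P π f True) (rankLetter P π f False) s

section LowerBound

variable {Q S : Type*} [Nonempty Q] {P : Finset ℕ} {π : ℕ} {f g : Q → ℕ → ℕ}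
  {B : BuchiAutomaton S (Letter Q P)}

/-- A state dead only for `g` could be reached over the prefix of `f` and would then loop with the
even priority `π` over the accepting loop of `g`. -/
theorem RankState.dead_imp (hB : B.language = (fullParity Q P).languageᶜ)
    (hP : ∀ j, 1 ≤ j → j ≤ π → j ∈ P) (hπ : 2 ≤ π) (hf : IsRank π f) {s : S}
    (hsf : RankState B π f s) (hsg : RankState B π g s) {q : Q} (hq : Dead π g q) :
    Dead π f q := by
  by_contra hqf
  obtain ⟨s₀, pre, -, -, hs₀, hpre, hlpre, -⟩ := hsf
  obtain ⟨-, -, u, -, -, -, -, hlu, hu, -⟩ := hsg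
  obtain ⟨q₀, hq₀⟩ := exists_walk_of_not_dead hf hP hπ hqf hlpre
  have h := BuchiAutomaton.lasso_mem_language (killLetter P π f) hs₀ hpre hu
  rw [hB] at h
  exact h (lasso_mem_language_fullParity _ hq.1 hq₀ (hitWalk_of_dead hP hπ hq hu.ne_nil hlu))

/-- The accepting loop of `f` followed by the weak loop of `g` is an accepting loop of `B`, so the
parity automaton must reject the lasso. -/
theorem RankState.not_mixedCycle (hB : B.language = (fullParity Q P).languageᶜ)
    (hP : ∀ j, 1 ≤ j → j ≤ π → j ∈ P) (hπ : 2 ≤ π) (hf : IsRank π f) {s : S}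
    (hsf : RankState B π f s) (hsg : RankState B π g s) : ¬ MixedCycle P π f g := by
  rintro ⟨q, e, he, hq, hcycle⟩
  obtain ⟨s₀, pre, u, -, hs₀, hpre, hlpre, hlu, hu, -⟩ := hsf
  obtain ⟨-, -, -, v, -, -, -, -, -, hvne, hlv, hv⟩ := hsg
  obtain ⟨q₀, hq₀⟩ := exists_walk_of_not_dead hf hP hπ hq hlpre
  have h := BuchiAutomaton.lasso_mem_language (killLetter P π f) hs₀ hpre (hu.append hv)
  rw [hB] at h
  exact h (lasso_mem_language_fullParity _ he hq₀ (hcycle u v hu.ne_nil hvne hlu hlv))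

theorem RankState.unique (hB : B.language = (fullParity Q P).languageᶜ)
    (hP : ∀ j, 1 ≤ j → j ≤ π → j ∈ P) (hπ : 2 ≤ π) (hf : IsRank π f) (hg : IsRank π g) {s : S}
    (hsf : RankState B π f s) (hsg : RankState B π g s) : f = g := by
  by_contra hne
  rcases mixedCycle_of_ne hf hg hP (fun q => ⟨hsg.dead_imp hB hP hπ hg hsf,
    hsf.dead_imp hB hP hπ hf hsg⟩) hne with h | h
  · exact hsf.not_mixedCycle hB hP hπ hf hsg h
  · exact hsg.not_mixedCycle hB hP hπ hg hsf h

theorem exists_rankState [Fintype S] (hB : B.language = (fullParity Q P).languageᶜ)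
    (hP : ∀ j ∈ P, j ≤ π) (f : Q → ℕ → ℕ) : ∃ s, RankState B π f s := by
  refine exists_recurs ?_
  rw [hB]
  exact not_mem_language_of_rank hP rfl (fun i hi => blockWord_mem hi) blockWord_frequently

end LowerBound

theorem mainTheorem2 {Q : Type*} [Fintype Q] [Nonempty Q]
    (P : Finset ℕ) (hP : P.Nonempty)
    (hmin : P.min' hP = 0 ∨ P.min' hP = 1)
    (hholes : ∀ i, P.min' hP ≤ i → i ≤ P.max' hP → i ∈ P)
    (hmax : 2 ≤ P.max' hP)
    {S : Type*} [Fintype S] (B : BuchiAutomaton S (Letter Q P))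
    (hB : B.language = (fullParity Q P).languageᶜ) :
    Finite {t : FNHT Q (P.max' hP) // t.IsFull} ∧
      Nat.card {t : FNHT Q (P.max' hP) // t.IsFull} ≤ Fintype.card S := by
  -- Priority `0` is never needed, so both values of the minimum are treated alike.
  have hmem : ∀ j, 1 ≤ j → j ≤ P.max' hP → j ∈ P := fun j h1 h2 =>
    hholes j (by rcases hmin with h | h <;> omega) h2
  choose F hF using fun t : {t : FNHT Q (P.max' hP) // t.IsFull} =>
    exists_rankState (π := P.max' hP) hB (fun j hj => P.le_max' j hj) t.1.rank
  have hinj : Function.Injective F := by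
    intro t t' h
    have h' := hF t'
    rw [← h] at h'
    exact Subtype.ext (FNHT.eq_of_rank_eq t.2 t'.2
      ((hF t).unique hB hmem hmax t.1.isRank_rank t'.1.isRank_rank h'))
  refine ⟨Finite.of_injective F hinj, ?_⟩
  rw [← Nat.card_eq_fintype_card]
  exact Nat.card_le_card_of_injective F hinj
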